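/- Let $n \ge 2$ and let $K \subset \mathbb{R}^n$ be a symmetric convex body, that is, a compact convex set with nonempty interior such that $-K = K$. For a symmetric convex body $L \subset \mathbb{R}^n$ and $N \ge n$, let $x_1, \dots, x_N$ be independent random points uniformly distributed in $L$ and put $$V_{L,N} = \frac{\operatorname{vol}_n\bigl(\operatorname{conv}\{\pm x_1, \dots, \pm x_N\}\bigr)}{\operatorname{vol}_n(L)}.$$ Let $v \in \mathbb{R}^n \setminus \{0\}$, let $\pi_v : \mathbb{R}^n \to v^\perp$ be the orthogonal projection, let $\beta : \pi_v(K) \to \mathbb{R}$ be odd ($\beta(-y) = -\beta(y)$), and let $I \subset \mathbb{R}$ be an interval that contains $0$ and has more than one point. Suppose that the sets $$K_t = \{x + t\,\beta(\pi_v(x))\,v : x \in K\}, \qquad t \in I,$$ are all convex; such a family is called an SRS-movement of $K$ with speed function $\beta$ (each $K_t$ is then again a symmetric convex body). Then for every real $p \ge 1$ and every integer $N \ge n$ the function $t \mapsto \mathbb{E}\, V_{K_t,N}^p$ is convex on $I$. Furthermore, for each such $p$ and $N$, this function is strictly convex on $I$ if and only if $\beta$ is not linear, that is, not the restriction to $\pi_v(K)$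 of a linear functional on $v^\perp$. -/

import Mathlib

open MeasureTheory ProbabilityTheory

open scoped Pointwise

noncomputable section

/-- Convex bodies that are symmetric about the origin: compact convex sets with interior points
and `-K = K`. -/
structure IsSymmetricConvexBody {n : ℕ} (K : Set (EuclideanSpace ℝ (Fin n))) : Prop where
  isCompact : IsCompact K
  convex : Convex ℝ K
  interior_nonempty : (interior K).Nonempty
  neg_eq : -K = K

/-- The hyperplane `v^⊥`. -/
abbrev perp {n : ℕ} (v : EuclideanSpace ℝ (Fin n)) :
    Submodule ℝ (EuclideanSpace ℝ (Fin n)) :=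
  (Submodule.span ℝ {v})ᗮ

/-- The orthogonal projection `π_v` onto `v^⊥`. -/
def projPerp {n : ℕ} (v : EuclideanSpace ℝ (Fin n)) :
    EuclideanSpace ℝ (Fin n) →L[ℝ] perp v :=
  (perp v).orthogonalProjectionOnto

/-- `K_t = {x + t β(π_v(x)) v : x ∈ K}`. Only the values of `β` on `π_v(K)` matter. -/
def movedBody {n : ℕ} (K : Set (EuclideanSpace ℝ (Fin n))) (v : EuclideanSpace ℝ (Fin n))
    (β : perp v → ℝ) (t : ℝ) : Set (EuclideanSpace ℝ (Fin n)) :=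
  (fun x => x + (t * β (projPerp v x)) • v) '' K

/-- The sets `K_t`, `t ∈ I`, form an RS-movement of `K` in direction `v` with speed function
`β` on `π_v(K)`. -/
structure IsRSMovement {n : ℕ} (K : Set (EuclideanSpace ℝ (Fin n)))
    (v : EuclideanSpace ℝ (Fin n)) (β : perp v → ℝ) (I : Set ℝ) : Prop where
  direction_ne_zero : v ≠ 0
  interval : I.OrdConnected
  zero_mem : (0 : ℝ) ∈ I
  convex_movedBody : ∀ t ∈ I, Convex ℝ (movedBody K v β t)

/-- An RS-movement whose speed function is odd on `π_v(K)`. -/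
structure IsSRSMovement {n : ℕ} (K : Set (EuclideanSpace ℝ (Fin n)))
    (v : EuclideanSpace ℝ (Fin n)) (β : perp v → ℝ) (I : Set ℝ) : Prop
    extends IsRSMovement K v β I where
  odd : ∀ y ∈ projPerp v '' K, β (-y) = -β y

/-- The speed function is linear on `π_v(K)`: it is the restriction of a linear functional
on `v^⊥`. -/
def IsLinearSpeed {n : ℕ} (K : Set (EuclideanSpace ℝ (Fin n)))
    (v : EuclideanSpace ℝ (Fin n)) (β : perp v → ℝ) : Prop :=
  ∃ l : perp v →ₗ[ℝ] ℝ, ∀ y ∈ projPerp v '' K, β y = l y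

/-- `V_{K,N}` as a function of the sample points: the normalized volume of
`conv {± x_1, …, ± x_N}`. -/
def symHullVolume {n N : ℕ} (K : Set (EuclideanSpace ℝ (Fin n)))
    (x : Fin N → EuclideanSpace ℝ (Fin n)) : ℝ :=
  volume.real (convexHull ℝ (Set.range x ∪ Set.range (-x))) / volume.real K

/-- `E V_{K,N}^p`: the `p`-th moment of `V_{K,N}` for `N` independent points, each uniformly
distributed in `K`. -/
def symMoment {n : ℕ} (K : Set (EuclideanSpace ℝ (Fin n))) (N : ℕ) (p : ℝ) : ℝ :=
  ∫ x : Fin N → EuclideanSpace ℝ (Fin n), symHullVolume K x ^ p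
    ∂(Measure.pi fun _ => cond volume K)

end

/-! The shear `x ↦ x + t β(π_v x) v` preserves volume, so it carries the uniform law on `K` to that
on `K_t`. The moment at time `t` is therefore an integral over a fixed probability space, that of
`N` points in `K`, of the p-th power of the normalized volume of `conv {± (x_i + t β(π_v x_i) v)}`
(`symMoment_movedBody`). For fixed points this volume is convex in `t`: every fibre of the hull
parallel to `v` is a segment, and the fibre at an intermediate time lies in the corresponding
combination of the fibres at the end times (`volume_symHull_le`). Since `u ↦ u ^ p` is convex and
increasing, integration preserves convexity.

If `β` is linear, the shears are linear and volume preserving, so the moment is constant. If not,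
there are `n` points in the interior of `K` whose sheared determinant is `(t - t₀) κ` with `κ ≠ 0`,
for any prescribed `t₀` (`exists_vecDet_shear`). The hull volume of these points is a multiple of
`|t - t₀|`; a kink placed between the times compared makes the inequality strict. Extra sample
points near `0` do not change the hull, and strictness persists on a neighbourhood, which has
positive measure.

`β` is arbitrary on the boundary of `π_v(K)`, apart from oddness and convexity of the `K_t`. On the
interior it is continuous, being a multiple of a difference of convex functions. As the boundary is
null, `β` is replaced by a measurable `b` that agrees with it on the interior. -/

/-- The convex hull of the points `± x i`. -/
def symHull {ι M : Type*} [AddCommGroup M] [Module ℝ M] (x : ι → M) : Set M :=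
  convexHull ℝ (Set.range x ∪ Set.range (-x))

/-! ### Symmetric hulls, parametrized by the ℓ¹ ball. -/

section SymHull

variable {ι M M' : Type*} [AddCommGroup M] [Module ℝ M] [AddCommGroup M'] [Module ℝ M']

theorem image_symHull (f : M →ₗ[ℝ] M') (x : ι → M) : f '' symHull x = symHull (f ∘ x) := by
  unfold symHull
  rw [f.image_convexHull, Set.image_union, ← Set.range_comp, ← Set.range_comp]
  congr 3
  funext i
  simp

theorem symHull_subset {x : ι → M} {s : Set M} (hs : Convex ℝ s) (hneg : ∀ y ∈ s, -y ∈ s)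
    (hx : ∀ i, x i ∈ s) : symHull x ⊆ s := by
  refine convexHull_min ?_ hs
  rintro _ (⟨i, rfl⟩ | ⟨i, rfl⟩)
  · exact hx i
  · exact hneg _ (hx i)

theorem symHull_eq_image [Fintype ι] [Nonempty ι] (x : ι → M) :
    symHull x = (fun c : ι → ℝ => ∑ i, c i • x i) '' {c | ∑ i, |c i| ≤ 1} := by
  classical
  apply Set.Subset.antisymm
  · refine symHull_subset ?_ ?_ ?_
    · have hlin : (fun c : ι → ℝ => ∑ i, c i • x i) = (Fintype.linearCombination ℝ x) := by
        funext c
        simp [Fintype.linearCombination_apply]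
      rw [hlin]
      refine Convex.linear_image ?_ _
      intro c hc d hd a b ha hb hab
      simp only [Set.mem_ofPred_eq, Pi.add_apply, Pi.smul_apply, smul_eq_mul] at *
      calc ∑ i, |a * c i + b * d i| ≤ ∑ i, (a * |c i| + b * |d i|) := by
            refine Finset.sum_le_sum fun i _ => (abs_add_le _ _).trans ?_
            rw [abs_mul, abs_mul, abs_of_nonneg ha, abs_of_nonneg hb]
        _ = a * ∑ i, |c i| + b * ∑ i, |d i| := by
            rw [Finset.sum_add_distrib, Finset.mul_sum, Finset.mul_sum]
        _ ≤ 1 := by nlinarith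
    · rintro _ ⟨c, hc, rfl⟩
      refine ⟨-c, by simpa using hc, by simp⟩
    · intro i
      refine ⟨Pi.single i 1, ?_, ?_⟩
      · rw [Set.mem_ofPred_eq, Finset.sum_eq_single i] <;> simp +contextual
      · simp [Pi.single_apply, ite_smul]
  · rintro _ ⟨c, hc, rfl⟩
    have hconv : Convex ℝ (symHull x) := convex_convexHull ℝ _
    have hpos : ∀ i, x i ∈ symHull x := fun i => subset_convexHull ℝ _ (Or.inl ⟨i, rfl⟩)
    have hneg : ∀ i, -x i ∈ symHull x := fun i => subset_convexHull ℝ _ (Or.inr ⟨i, rfl⟩)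
    have hzero : (0 : M) ∈ symHull x := by
      obtain ⟨i⟩ := ‹Nonempty ι›
      have := hconv (hpos i) (hneg i) (by norm_num : (0 : ℝ) ≤ 1 / 2)
        (by norm_num : (0 : ℝ) ≤ 1 / 2) (by norm_num)
      simpa using this
    have hsum : 0 ≤ ∑ i, |c i| := Finset.sum_nonneg fun i _ => abs_nonneg _
    rcases hsum.eq_or_lt with h0 | h0
    · have : ∀ i, c i = 0 := fun i => by
        have := (Finset.sum_eq_zero_iff_of_nonneg fun i _ => abs_nonneg (c i)).1 h0.symm i
          (Finset.mem_univ i)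
        simpa using this
      simpa [this] using hzero
    -- Normalizing the `|c i|` gives a convex combination of the points `± x i`; where `c i = 0` the
    -- point is `0`, with weight zero. Scaling towards `0` by `∑ |c i| ≤ 1` then recovers the given
    -- point.
    · have hmem : ∑ i, (|c i| / ∑ j, |c j|) • ((SignType.sign (c i) : ℝ) • x i) ∈ symHull x := by
        refine hconv.sum_mem (fun i _ => by positivity) ?_ ?_
        · rw [← Finset.sum_div, div_self h0.ne']
        · intro i _
          rcases lt_trichotomy (c i) 0 with h | h | h
          · simpa [sign_neg h] using hneg i
          · simpa [h] using hzero
          · simpa [sign_pos h] using hpos i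
      have := hconv.smul_mem_of_zero_mem hzero hmem ⟨hsum, hc⟩
      convert this using 1
      rw [Finset.smul_sum]
      refine Finset.sum_congr rfl fun i _ => ?_
      rw [smul_smul, smul_smul]
      congr 1
      rw [mul_div_cancel₀ _ h0.ne', mul_comm, sign_mul_abs]

theorem symHull_eq_of_forall_mem {ι' : Type*} {x : ι → M} (e : ι' → ι)
    (h : ∀ i, x i ∈ symHull (x ∘ e)) : symHull x = symHull (x ∘ e) := by
  apply Set.Subset.antisymm
  · refine symHull_subset (convex_convexHull ℝ _) ?_ h
    intro y hy
    have : (-LinearMap.id : M →ₗ[ℝ] M) '' symHull (x ∘ e) = symHull (x ∘ e) := by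
      rw [image_symHull]
      unfold symHull
      rw [Set.union_comm]
      congr 3
      funext i
      simp
    rw [← this]
    exact ⟨y, hy, rfl⟩
  · exact convexHull_mono (Set.union_subset_union (by grind) (by
      rintro _ ⟨i, rfl⟩
      exact ⟨e i, rfl⟩))

theorem isCompact_abs_sum_le (ι : Type*) [Fintype ι] :
    IsCompact {c : ι → ℝ | ∑ i, |c i| ≤ 1} := by
  refine IsCompact.of_isClosed_subset (isCompact_univ_pi fun _ : ι => isCompact_Icc (a := (-1 : ℝ))
    (b := 1)) (isClosed_le (by fun_prop) continuous_const) ?_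
  intro c hc i _
  have := (Finset.single_le_sum (f := fun i => |c i|) (fun i _ => abs_nonneg _)
    (Finset.mem_univ i)).trans hc
  exact abs_le.1 this

theorem isCompact_symHull [Fintype ι] [TopologicalSpace M] [IsTopologicalAddGroup M]
    [ContinuousSMul ℝ M] (x : ι → M) : IsCompact (symHull x) :=
  ((Set.finite_range x).union (Set.finite_range (-x))).isCompact_convexHull ℝ

/-- The incidence set of pairs (points, element of their hull) is the projection of a closed set
along the compact ℓ¹ ball, hence closed; the volume of its sections is then measurable. -/
theorem measurable_volume_symHull {M : Type*} [NormedAddCommGroup M] [NormedSpace ℝ M]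
    [FiniteDimensional ℝ M] [MeasurableSpace M] [BorelSpace M] (μ : Measure M) [SFinite μ]
    [Fintype ι] [Nonempty ι] : Measurable fun x : ι → M => μ.real (symHull x) := by
  have hclosed : IsClosed {q : (ι → M) × M | q.2 ∈ symHull q.1} := by
    have : CompactSpace {c : ι → ℝ | ∑ i, |c i| ≤ 1} :=
      isCompact_iff_compactSpace.1 (isCompact_abs_sum_le ι)
    have hC : IsClosed {r : {c : ι → ℝ | ∑ i, |c i| ≤ 1} × ((ι → M) × M) |
        ∑ i, (r.1 : ι → ℝ) i • r.2.1 i = r.2.2} := by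
      refine isClosed_eq (continuous_finsetSum _ fun i _ => ?_) (by fun_prop)
      exact (((continuous_apply i).comp continuous_subtype_val).comp continuous_fst).smul
        ((continuous_apply i).comp (continuous_fst.comp continuous_snd))
    convert isClosedMap_snd_of_compactSpace _ hC using 1
    ext ⟨x, z⟩
    simp [symHull_eq_image]
  have : ProperSpace M := FiniteDimensional.proper_real M
  exact (measurable_measure_prodMk_left hclosed.measurableSet).ennreal_toReal

end SymHull

/-! ### Convexity in time of the hull volume, fibre by fibre. -/

theorem measure_le_of_subset_add {A B C : Set ℝ} (hA : Convex ℝ A) (hA' : IsCompact A)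
    (hB : Convex ℝ B) (hB' : IsCompact B) {l m : ℝ} (hl : 0 ≤ l) (hm : 0 ≤ m)
    (hC : ∀ z ∈ C, ∃ x ∈ A, ∃ y ∈ B, l * x + m * y = z) :
    volume C ≤ ENNReal.ofReal l * volume A + ENNReal.ofReal m * volume B := by
  rcases C.eq_empty_or_nonempty with rfl | ⟨z, hz⟩
  · simp
  obtain ⟨x, hx, y, hy, -⟩ := hC z hz
  have hAI := eq_Icc_of_connected_compact ⟨⟨x, hx⟩, hA.isPreconnected⟩ hA'
  have hBI := eq_Icc_of_connected_compact ⟨⟨y, hy⟩, hB.isPreconnected⟩ hB'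
  have hsub : C ⊆ Set.Icc (l * sInf A + m * sInf B) (l * sSup A + m * sSup B) := by
    intro z hz
    obtain ⟨x, hx, y, hy, rfl⟩ := hC z hz
    rw [hAI] at hx
    rw [hBI] at hy
    exact ⟨by gcongr; exacts [hx.1, hy.1], by gcongr; exacts [hx.2, hy.2]⟩
  have hA0 : 0 ≤ sSup A - sInf A := by rw [hAI] at hx; linarith [hx.1, hx.2]
  have hB0 : 0 ≤ sSup B - sInf B := by rw [hBI] at hy; linarith [hy.1, hy.2]
  refine (measure_mono hsub).trans ?_
  rw [hAI, hBI, Real.volume_Icc, Real.volume_Icc, Real.volume_Icc, ← ENNReal.ofReal_mul hl,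
    ← ENNReal.ofReal_mul hm, ← ENNReal.ofReal_add (by positivity) (by positivity), ← hAI, ← hBI]
  exact le_of_eq (by ring_nf)

/-- The base points `y i` do not move and the heights are affine in time. The coefficients `c` that
represent a point of the fibre over `q` at the intermediate time thus represent points over the same
`q` at times `a` and `b`, and the three heights satisfy the same convex combination. Fubini reduces
the claim to lengths of segments. -/
theorem prod_symHull_add_le {F ι : Type*} [NormedAddCommGroup F] [NormedSpace ℝ F]
    [FiniteDimensional ℝ F] [MeasurableSpace F] [BorelSpace F] (μ : Measure F) [SFinite μ]
    [Fintype ι] [Nonempty ι] (y : ι → F) (s r : ι → ℝ) {l m : ℝ} (hl : 0 ≤ l) (hm : 0 ≤ m)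
    (hlm : l + m = 1) (a b : ℝ) :
    (μ.prod volume) (symHull fun i => (y i, s i + (l * a + m * b) * r i)) ≤
      ENNReal.ofReal l * (μ.prod volume) (symHull fun i => (y i, s i + a * r i)) +
      ENNReal.ofReal m * (μ.prod volume) (symHull fun i => (y i, s i + b * r i)) := by
  have : ProperSpace F := FiniteDimensional.proper_real F
  have hmeas : ∀ t : ℝ, MeasurableSet (symHull fun i => (y i, s i + t * r i)) :=
    fun t => (isCompact_symHull _).isClosed.measurableSet
  have hmem : ∀ (t : ℝ) (q : F) (z : ℝ), (q, z) ∈ (symHull fun i => (y i, s i + t * r i)) ↔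
      ∃ c : ι → ℝ, ∑ i, |c i| ≤ 1 ∧ ∑ i, c i • y i = q ∧ ∑ i, c i * (s i + t * r i) = z := by
    intro t q z
    simp [symHull_eq_image, Prod.ext_iff, Prod.fst_sum, Prod.snd_sum]
  have hfib : ∀ (t : ℝ) (q : F),
      Convex ℝ (Prod.mk q ⁻¹' (symHull fun i => (y i, s i + t * r i))) := by
    intro t q z hz w hw c d hc hd hcd
    have hconv : Convex ℝ (symHull fun i => (y i, s i + t * r i)) := convex_convexHull ℝ _
    have := hconv hz hw hc hd hcd
    simpa [← add_smul, hcd] using this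
  have hfib' : ∀ (t : ℝ) (q : F),
      IsCompact (Prod.mk q ⁻¹' (symHull fun i => (y i, s i + t * r i))) := by
    intro t q
    refine ((isCompact_symHull fun i => (y i, s i + t * r i)).image continuous_snd).of_isClosed_subset
      ((isCompact_symHull _).isClosed.preimage (by fun_prop)) ?_
    intro z hz
    exact ⟨_, hz, rfl⟩
  rw [Measure.prod_apply (hmeas _), Measure.prod_apply (hmeas _), Measure.prod_apply (hmeas _),
    ← lintegral_const_mul _ (measurable_measure_prodMk_left (hmeas _)),
    ← lintegral_const_mul _ (measurable_measure_prodMk_left (hmeas _)),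
    ← lintegral_add_left ((measurable_measure_prodMk_left (hmeas _)).const_mul _)]
  refine lintegral_mono fun q => ?_
  refine measure_le_of_subset_add (hfib a q) (hfib' a q) (hfib b q) (hfib' b q) hl hm ?_
  intro z hz
  obtain ⟨c, hc, hq, rfl⟩ := (hmem _ _ _).1 hz
  refine ⟨_, (hmem _ _ _).2 ⟨c, hc, hq, rfl⟩, _, (hmem _ _ _).2 ⟨c, hc, hq, rfl⟩, ?_⟩
  rw [Finset.mul_sum, Finset.mul_sum, ← Finset.sum_add_distrib]
  refine Finset.sum_congr rfl fun i _ => ?_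
  linear_combination (c i * s i) * hlm

/-! ### The splitting of the space along `v`, and shears. -/

section Shear

variable {n : ℕ} {v : EuclideanSpace ℝ (Fin n)}

@[simp]
theorem projPerp_self (v : EuclideanSpace ℝ (Fin n)) : projPerp v v = 0 :=
  Submodule.orthogonalProjectionOnto_orthogonalComplement_singleton_eq_zero v

@[simp]
theorem projPerp_coe (y : perp v) : projPerp v (y : EuclideanSpace ℝ (Fin n)) = y :=
  Submodule.orthogonalProjectionOnto_mem_subspace_eq_self y

theorem projPerp_add_smul (v x : EuclideanSpace ℝ (Fin n)) :
    (projPerp v x : EuclideanSpace ℝ (Fin n)) + (inner ℝ v x / ‖v‖ ^ 2) • v = x := by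
  have h := (Submodule.span ℝ {v}).starProjection_add_starProjection_orthogonal x
  rw [Submodule.starProjection_singleton, add_comm] at h
  exact h

theorem inner_perp (y : perp v) : inner ℝ v (y : EuclideanSpace ℝ (Fin n)) = 0 :=
  Submodule.mem_orthogonal_singleton_iff_inner_right.1 y.2

/-- The decomposition of the space into `v^⊥` and the line spanned by `v`. -/
noncomputable def perpProdEquiv (v : EuclideanSpace ℝ (Fin n)) (hv : v ≠ 0) :
    (perp v × ℝ) ≃L[ℝ] EuclideanSpace ℝ (Fin n) :=
  LinearEquiv.toContinuousLinearEquiv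
    { toFun := fun q => (q.1 : EuclideanSpace ℝ (Fin n)) + q.2 • v
      map_add' := fun q r => by simp [add_smul]; abel
      map_smul' := fun c q => by simp [mul_smul]
      invFun := fun x => (projPerp v x, inner ℝ v x / ‖v‖ ^ 2)
      left_inv := fun q => by
        have hv' : ‖v‖ ^ 2 ≠ 0 := by simpa using hv
        ext1
        · simp
        · simp [inner_add_right, inner_smul_right, inner_perp, hv]
      right_inv := fun x => projPerp_add_smul v x }

theorem perpProdEquiv_apply (hv : v ≠ 0) (q : perp v × ℝ) :
    perpProdEquiv v hv q = (q.1 : EuclideanSpace ℝ (Fin n)) + q.2 • v := rfl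

/-- Uniqueness of Haar measure. The value of `c` never matters, as only linear relations between
volumes are transported. -/
theorem exists_volume_eq_smul_map (hv : v ≠ 0) : ∃ c : ENNReal,
    (volume : Measure (EuclideanSpace ℝ (Fin n))) =
      c • Measure.map (perpProdEquiv v hv) ((volume : Measure (perp v)).prod volume) :=
  ⟨_, Measure.isAddLeftInvariant_eq_smul _ _⟩

theorem volume_symHull_le (hv : v ≠ 0) {ι : Type*} [Fintype ι] [Nonempty ι]
    (x : ι → EuclideanSpace ℝ (Fin n)) (r : ι → ℝ) {l m : ℝ} (hl : 0 ≤ l) (hm : 0 ≤ m)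
    (hlm : l + m = 1) (a b : ℝ) :
    volume.real (symHull fun i => x i + ((l * a + m * b) * r i) • v) ≤
      l * volume.real (symHull fun i => x i + (a * r i) • v) +
      m * volume.real (symHull fun i => x i + (b * r i) • v) := by
  obtain ⟨c, hvol⟩ := exists_volume_eq_smul_map hv
  set Φ := perpProdEquiv v hv
  have hset : ∀ t : ℝ, Φ ⁻¹' (symHull fun i => x i + (t * r i) • v) =
      symHull fun i => ((Φ.symm (x i)).1, (Φ.symm (x i)).2 + t * r i) := by
    intro t
    rw [← Φ.image_symm_eq_preimage]
    refine (image_symHull Φ.symm.toLinearEquiv.toLinearMap _).trans ?_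
    congr 1
    funext i
    change Φ.symm (x i + (t * r i) • v) = _
    rw [ContinuousLinearEquiv.symm_apply_eq, perpProdEquiv_apply]
    conv_lhs => rw [← Φ.apply_symm_apply (x i), perpProdEquiv_apply]
    simp only [add_smul, add_assoc]
  have hmeas : ∀ t : ℝ, volume (symHull fun i => x i + (t * r i) • v) =
      c * ((volume : Measure (perp v)).prod volume)
        (symHull fun i => ((Φ.symm (x i)).1, (Φ.symm (x i)).2 + t * r i)) := by
    intro t
    rw [hvol, Measure.smul_apply, Measure.map_apply Φ.continuous.measurable
      (isCompact_symHull _).isClosed.measurableSet, hset, smul_eq_mul]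
  have hfin : ∀ t : ℝ, volume (symHull fun i => x i + (t * r i) • v) ≠ ⊤ :=
    fun t => (isCompact_symHull _).measure_lt_top.ne
  have key : volume (symHull fun i => x i + ((l * a + m * b) * r i) • v) ≤
      ENNReal.ofReal l * volume (symHull fun i => x i + (a * r i) • v) +
      ENNReal.ofReal m * volume (symHull fun i => x i + (b * r i) • v) := by
    rw [hmeas, hmeas, hmeas, mul_left_comm, mul_left_comm (ENNReal.ofReal m), ← mul_add]
    gcongr
    exact prod_symHull_add_le _ _ _ _ hl hm hlm a b
  have := ENNReal.toReal_mono (by finiteness [hfin a, hfin b]) key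
  rwa [ENNReal.toReal_add (by finiteness [hfin a]) (by finiteness [hfin b]), ENNReal.toReal_mul,
    ENNReal.toReal_mul, ENNReal.toReal_ofReal hl, ENNReal.toReal_ofReal hm] at this

/-- The shear `x ↦ x + t β(π_v x) v`. -/
noncomputable def shear (v : EuclideanSpace ℝ (Fin n)) (β : perp v → ℝ) (t : ℝ)
    (x : EuclideanSpace ℝ (Fin n)) : EuclideanSpace ℝ (Fin n) :=
  x + (t * β (projPerp v x)) • v

@[simp]
theorem projPerp_shear (β : perp v → ℝ) (t : ℝ) (x : EuclideanSpace ℝ (Fin n)) :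
    projPerp v (shear v β t x) = projPerp v x := by
  simp [shear]

theorem shear_neg_shear (β : perp v → ℝ) (t : ℝ) (x : EuclideanSpace ℝ (Fin n)) :
    shear v β (-t) (shear v β t x) = x := by
  conv_lhs => rw [shear]
  rw [projPerp_shear]
  simp [shear]

theorem shear_shear_neg (β : perp v → ℝ) (t : ℝ) (x : EuclideanSpace ℝ (Fin n)) :
    shear v β t (shear v β (-t) x) = x := by
  simpa using shear_neg_shear β (-t) x

theorem measurable_shear {β : perp v → ℝ} (hβ : Measurable β) (t : ℝ) :
    Measurable (shear v β t) := by
  unfold shear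
  have := (projPerp v).continuous.measurable
  fun_prop

theorem image_shear (β : perp v → ℝ) (t : ℝ) (s : Set (EuclideanSpace ℝ (Fin n))) :
    shear v β t '' s = shear v β (-t) ⁻¹' s :=
  congrFun (Set.image_eq_preimage_of_inverse (shear_neg_shear β t) (shear_shear_neg β t)) s

/-- In the coordinates `v^⊥ × ℝ` the shear translates each fibre, so measurability of `β` suffices.
-/
theorem measurePreserving_shear (hv : v ≠ 0) {β : perp v → ℝ} (hβ : Measurable β) (t : ℝ) :
    MeasurePreserving (shear v β t) volume volume := by
  obtain ⟨c, hvol⟩ := exists_volume_eq_smul_map hv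
  set Φ := perpProdEquiv v hv with hΦ
  have hprod : MeasurePreserving (fun q : perp v × ℝ => (q.1, q.2 + t * β q.1))
      ((volume : Measure (perp v)).prod volume) ((volume : Measure (perp v)).prod volume) := by
    refine MeasurePreserving.skew_product (f := id) (g := fun y s => s + t * β y)
      (MeasurePreserving.id _) ?_ ?_
    · simp only [Function.uncurry_def]
      fun_prop
    · exact Filter.Eventually.of_forall fun y => map_add_right_eq_self volume _
  have hcomm : shear v β t ∘ Φ = Φ ∘ fun q : perp v × ℝ => (q.1, q.2 + t * β q.1) := by
    funext q
    simp only [Function.comp_apply, shear, perpProdEquiv_apply, hΦ, map_add, map_smul,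
      projPerp_coe, projPerp_self, smul_zero, add_zero, add_smul, add_assoc]
  have hΦm : Measurable Φ := Φ.continuous.measurable
  refine ⟨measurable_shear hβ t, ?_⟩
  rw [hvol, Measure.map_smul, Measure.map_map (measurable_shear hβ t) hΦm, hcomm,
    ← Measure.map_map hΦm hprod.measurable, hprod.map_eq]

theorem volume_image_shear (hv : v ≠ 0) {β : perp v → ℝ} (hβ : Measurable β) (t : ℝ)
    {s : Set (EuclideanSpace ℝ (Fin n))}
    (hs : NullMeasurableSet s (volume : Measure (EuclideanSpace ℝ (Fin n)))) :
    volume (shear v β t '' s) = volume s := by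
  rw [image_shear, (measurePreserving_shear hv hβ (-t)).measure_preimage hs]

theorem volume_projPerp_preimage_eq_zero (hv : v ≠ 0) {s : Set (perp v)}
    (hs : (volume : Measure (perp v)) s = 0) :
    (volume : Measure (EuclideanSpace ℝ (Fin n))) (projPerp v ⁻¹' s) = 0 := by
  obtain ⟨c, hvol⟩ := exists_volume_eq_smul_map hv
  have hnull : Measure.map (perpProdEquiv v hv) ((volume : Measure (perp v)).prod volume)
      (projPerp v ⁻¹' s) = 0 := by
    have : Measure.map (perpProdEquiv v hv) ((volume : Measure (perp v)).prod volume)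
        (projPerp v ⁻¹' s) = ((volume : Measure (perp v)).prod (volume : Measure ℝ)) (s ×ˢ Set.univ) := by
      refine ((perpProdEquiv v hv).toHomeomorph.toMeasurableEquiv.map_apply _).trans ?_
      congr 1
      ext q
      change projPerp v (q.1 + q.2 • v) ∈ s ↔ _
      simp
    rw [this, Measure.prod_prod, hs, zero_mul]
  rw [hvol, Measure.smul_apply, hnull, smul_zero]

end Shear

/-! ### Projections of the body and regularity of the speed function. -/

section Body

variable {n : ℕ} {K : Set (EuclideanSpace ℝ (Fin n))} {v : EuclideanSpace ℝ (Fin n)}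
  {β : perp v → ℝ} {I : Set ℝ}

theorem IsSymmetricConvexBody.neg_mem (hK : IsSymmetricConvexBody K)
    {x : EuclideanSpace ℝ (Fin n)} (hx : x ∈ K) : -x ∈ K := by
  rw [← hK.neg_eq]
  simpa using hx

theorem IsSymmetricConvexBody.zero_mem_interior (hK : IsSymmetricConvexBody K) :
    (0 : EuclideanSpace ℝ (Fin n)) ∈ interior K := by
  obtain ⟨x, hx⟩ := hK.interior_nonempty
  have hx' : -x ∈ interior K := by
    have h : (Homeomorph.neg (EuclideanSpace ℝ (Fin n))) ⁻¹' K = K := hK.neg_eq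
    have h' := (Homeomorph.neg (EuclideanSpace ℝ (Fin n))).preimage_interior K
    rw [h] at h'
    rw [← h'] at hx
    exact hx
  have := hK.convex.interior hx hx' (by norm_num : (0 : ℝ) ≤ 1 / 2)
    (by norm_num : (0 : ℝ) ≤ 1 / 2) (by norm_num)
  simpa using this

theorem IsSymmetricConvexBody.smul_mem_interior (hK : IsSymmetricConvexBody K)
    {x : EuclideanSpace ℝ (Fin n)} (hx : x ∈ K) {r : ℝ} (h0 : 0 ≤ r) (h1 : r < 1) :
    r • x ∈ interior K := by
  have := hK.convex.combo_interior_self_mem_interior hK.zero_mem_interior hx (sub_pos.2 h1) h0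
    (by ring)
  simpa using this

theorem IsSymmetricConvexBody.convex_image_projPerp (hK : IsSymmetricConvexBody K) :
    Convex ℝ (projPerp v '' K) :=
  hK.convex.linear_image (projPerp v).toLinearMap

theorem projPerp_mem_interior {x : EuclideanSpace ℝ (Fin n)} (hx : x ∈ interior K) :
    projPerp v x ∈ interior (projPerp v '' K) := by
  have hopen : IsOpenMap (projPerp v) :=
    (projPerp v).isOpenMap fun y => ⟨y, projPerp_coe y⟩
  exact hopen.image_interior_subset K ⟨x, hx, rfl⟩

theorem IsSymmetricConvexBody.smul_mem_interior_image (hK : IsSymmetricConvexBody K)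
    {y : perp v} (hy : y ∈ projPerp v '' K) {r : ℝ} (h0 : 0 ≤ r) (h1 : r < 1) :
    r • y ∈ interior (projPerp v '' K) := by
  obtain ⟨x, hx, rfl⟩ := hy
  rw [← map_smul]
  exact projPerp_mem_interior (hK.smul_mem_interior hx h0 h1)

theorem IsSymmetricConvexBody.interior_image_subset (hK : IsSymmetricConvexBody K) :
    interior (projPerp v '' K) ⊆ projPerp v '' interior K := by
  intro y hy
  -- An interior `y` can be pushed outwards to `r • y` with `r > 1`; scaling a preimage of that
  -- point back by `r⁻¹ < 1` lands in the interior of `K`.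
  have hcont : Filter.Tendsto (fun r : ℝ => r • y) (nhdsWithin 1 (Set.Ioi 1)) (nhds y) := by
    have : Continuous fun r : ℝ => r • y := by fun_prop
    simpa using (this.tendsto 1).mono_left nhdsWithin_le_nhds
  obtain ⟨r, hr, h1⟩ := ((hcont.eventually_mem (isOpen_interior.mem_nhds hy)).and
    self_mem_nhdsWithin).exists
  obtain ⟨x, hx, hxy⟩ := interior_subset hr
  refine ⟨r⁻¹ • x, hK.smul_mem_interior hx (by positivity) (inv_lt_one_of_one_lt₀ h1), ?_⟩
  rw [map_smul, hxy, smul_smul, inv_mul_cancel₀ (by positivity), one_smul]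

theorem movedBody_eq_preimage (β : perp v → ℝ) (t : ℝ) :
    movedBody K v β t = shear v β (-t) ⁻¹' K :=
  image_shear β t K

theorem add_smul_mem_movedBody_iff (β : perp v → ℝ) (t : ℝ) (y : perp v) (s : ℝ) :
    (y : EuclideanSpace ℝ (Fin n)) + s • v ∈ movedBody K v β t ↔
      (y : EuclideanSpace ℝ (Fin n)) + (s - t * β y) • v ∈ K := by
  rw [movedBody_eq_preimage, Set.mem_preimage, shear]
  simp only [map_add, map_smul, projPerp_coe, projPerp_self, smul_zero, add_zero, sub_eq_add_neg,
    add_smul, add_assoc, neg_mul]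

theorem exists_min_height (hK : IsCompact K) (hv : v ≠ 0) {y : perp v}
    (hy : y ∈ projPerp v '' K) : ∃ s : ℝ, (y : EuclideanSpace ℝ (Fin n)) + s • v ∈ K ∧
      ∀ s' : ℝ, (y : EuclideanSpace ℝ (Fin n)) + s' • v ∈ K → s ≤ s' := by
  have hcomp : IsCompact {s : ℝ | (y : EuclideanSpace ℝ (Fin n)) + s • v ∈ K} := by
    refine (hK.image (f := fun x => ((perpProdEquiv v hv).symm x).2)
      (by fun_prop)).of_isClosed_subset (hK.isClosed.preimage (by fun_prop)) ?_
    intro s hs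
    refine ⟨_, hs, ?_⟩
    have : (y : EuclideanSpace ℝ (Fin n)) + s • v = perpProdEquiv v hv (y, s) := rfl
    simp [this]
  obtain ⟨x, hx, rfl⟩ := hy
  obtain ⟨s, hs⟩ := hcomp.exists_isLeast ⟨_, by
    change _ + (inner ℝ v x / ‖v‖ ^ 2) • v ∈ K
    rwa [projPerp_add_smul]⟩
  exact ⟨s, hs.1, fun s' hs' => hs.2 hs'⟩

theorem IsSRSMovement.apply_zero (hK : IsSymmetricConvexBody K) (h : IsSRSMovement K v β I) :
    β 0 = 0 := by
  have := h.odd 0 ⟨0, interior_subset hK.zero_mem_interior, map_zero _⟩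
  rw [neg_zero] at this
  linarith

/-- With `f` the lower boundary of `K` over `v^⊥`, that of `K_t` is `f + t β`. Both are convex,
hence continuous on the interior, and `β` is their difference divided by some `t ≠ 0` in `I`. -/
theorem IsSRSMovement.continuousOn (hK : IsSymmetricConvexBody K) (h : IsSRSMovement K v β I)
    (hI : I.Nontrivial) : ContinuousOn β (interior (projPerp v '' K)) := by
  obtain ⟨t, ht, ht0⟩ := hI.exists_ne 0
  choose! f hfK hf using fun y (hy : y ∈ projPerp v '' K) =>
    exists_min_height hK.isCompact h.direction_ne_zero hy
  have hconv : ∀ t ∈ I, ConvexOn ℝ (projPerp v '' K) fun y => f y + t * β y := by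
    intro t ht
    refine ⟨hK.convex_image_projPerp, fun y hy z hz a b ha hb hab => ?_⟩
    have hy' : (y : EuclideanSpace ℝ (Fin n)) + (f y + t * β y) • v ∈ movedBody K v β t := by
      rw [add_smul_mem_movedBody_iff, add_sub_cancel_right]
      exact hfK y hy
    have hz' : (z : EuclideanSpace ℝ (Fin n)) + (f z + t * β z) • v ∈ movedBody K v β t := by
      rw [add_smul_mem_movedBody_iff, add_sub_cancel_right]
      exact hfK z hz
    have hmem := h.convex_movedBody t ht hy' hz' ha hb hab
    have heq : a • ((y : EuclideanSpace ℝ (Fin n)) + (f y + t * β y) • v) +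
        b • ((z : EuclideanSpace ℝ (Fin n)) + (f z + t * β z) • v) =
        ((a • y + b • z : perp v) : EuclideanSpace ℝ (Fin n)) +
          (a * (f y + t * β y) + b * (f z + t * β z)) • v := by
      push_cast
      module
    rw [heq, add_smul_mem_movedBody_iff] at hmem
    have := hf _ (hK.convex_image_projPerp hy hz ha hb hab) _ hmem
    simp only [smul_eq_mul]
    linarith
  have h0 := (hconv 0 h.zero_mem).continuousOn_interior
  have h1 := (hconv t ht).continuousOn_interior
  refine ((h1.sub h0).const_smul t⁻¹).congr fun y _ => ?_
  simp only [Pi.smul_apply, Pi.sub_apply, smul_eq_mul]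
  field_simp
  ring

/-- Linearity on the interior extends to the boundary. This rules out a speed that is nonlinear only
on a null set, which the moments could not detect. -/
theorem IsSRSMovement.eq_of_eq_on_interior (hK : IsSymmetricConvexBody K)
    (h : IsSRSMovement K v β I) (hI : I.Nontrivial) {l : perp v →ₗ[ℝ] ℝ}
    (hl : ∀ y ∈ interior (projPerp v '' K), β y = l y) {y : perp v}
    (hy : y ∈ projPerp v '' K) : β y = l y := by
  obtain ⟨t, ht, ht0⟩ := hI.exists_ne 0
  -- Take the lowest point of `K` over `y`, move it to `K_t`, contract it by `r < 1`, where the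
  -- speed is `l`, and move it back to `K`. As `r → 1` this yields a point of `K` over `y` raised by
  -- `t * (β y - l y)`, which cannot be negative by minimality. Oddness at `-y` gives the reverse
  -- inequality.
  have key : ∀ y ∈ projPerp v '' K, 0 ≤ t * (β y - l y) := by
    intro y hy
    obtain ⟨s, hs, hmin⟩ := exists_min_height hK.isCompact h.direction_ne_zero hy
    have hmem : ∀ r ∈ Set.Ioo (0 : ℝ) 1,
        r • ((y : EuclideanSpace ℝ (Fin n)) + (s + t * (β y - l y)) • v) ∈ K := by
      intro r hr
      have hs' : (y : EuclideanSpace ℝ (Fin n)) + (s + t * β y) • v ∈ movedBody K v β t := by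
        rw [add_smul_mem_movedBody_iff, add_sub_cancel_right]
        exact hs
      have h0 : (0 : EuclideanSpace ℝ (Fin n)) ∈ movedBody K v β t := by
        have := (add_smul_mem_movedBody_iff (K := K) β t 0 0).2 (by
          simpa [h.apply_zero hK] using interior_subset hK.zero_mem_interior)
        simpa using this
      have hmem := (h.convex_movedBody t ht).smul_mem_of_zero_mem h0 hs' ⟨hr.1.le, hr.2.le⟩
      have heq : r • ((y : EuclideanSpace ℝ (Fin n)) + (s + t * β y) • v) =
          ((r • y : perp v) : EuclideanSpace ℝ (Fin n)) + (r * (s + t * β y)) • v := by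
        push_cast
        module
      rw [heq, add_smul_mem_movedBody_iff,
        hl _ (hK.smul_mem_interior_image hy hr.1.le hr.2), map_smul] at hmem
      convert hmem using 1
      push_cast
      simp only [smul_eq_mul]
      module
    have hclosed : IsClosed {r : ℝ |
        r • ((y : EuclideanSpace ℝ (Fin n)) + (s + t * (β y - l y)) • v) ∈ K} :=
      hK.isCompact.isClosed.preimage (by fun_prop)
    have hone : (1 : ℝ) ∈ closure (Set.Ioo (0 : ℝ) 1) := by
      rw [closure_Ioo (by norm_num)]
      simp
    have hlim : (1 : ℝ) • ((y : EuclideanSpace ℝ (Fin n)) + (s + t * (β y - l y)) • v) ∈ K :=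
      closure_minimal (fun r hr => hmem r hr) hclosed hone
    rw [one_smul] at hlim
    have := hmin _ hlim
    linarith
  have h1 := key y hy
  have hneg : -y ∈ projPerp v '' K := by
    obtain ⟨x, hx, rfl⟩ := hy
    exact ⟨-x, hK.neg_mem hx, map_neg _ _⟩
  have h2 := key (-y) hneg
  rw [h.odd y hy, map_neg] at h2
  have : t * (β y - l y) = 0 := by linarith
  have := (mul_eq_zero.1 this).resolve_left ht0
  linarith

end Body

/-! ### The moment as an integral over fixed sample points; convexity and the linear case. -/

section Moment

variable {n : ℕ} {K : Set (EuclideanSpace ℝ (Fin n))} {v : EuclideanSpace ℝ (Fin n)}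
  {β b : perp v → ℝ} {I : Set ℝ}

theorem IsSymmetricConvexBody.volume_ne_zero (hK : IsSymmetricConvexBody K) : volume K ≠ 0 :=
  fun h => (Measure.measure_pos_of_nonempty_interior volume hK.interior_nonempty).ne' h

theorem IsSymmetricConvexBody.volume_real_pos (hK : IsSymmetricConvexBody K) :
    0 < volume.real K :=
  ENNReal.toReal_pos hK.volume_ne_zero hK.isCompact.measure_lt_top.ne

theorem IsSymmetricConvexBody.isProbabilityMeasure_cond (hK : IsSymmetricConvexBody K) :
    IsProbabilityMeasure (cond volume K) :=
  cond_isProbabilityMeasure_of_finite hK.volume_ne_zero hK.isCompact.measure_lt_top.ne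

/-- The frontier of a convex set is null, and so is its cylinder in direction `v`. -/
theorem IsSymmetricConvexBody.ae_projPerp (hK : IsSymmetricConvexBody K) (hv : v ≠ 0) :
    ∀ᵐ x : EuclideanSpace ℝ (Fin n), projPerp v x ∈ projPerp v '' K →
      projPerp v x ∈ interior (projPerp v '' K) := by
  have h0 : (volume : Measure (perp v)) (frontier (projPerp v '' K)) = 0 :=
    hK.convex_image_projPerp.addHaar_frontier volume
  have h1 := volume_projPerp_preimage_eq_zero hv h0
  rw [← compl_mem_ae_iff] at h1
  filter_upwards [h1] with x hx hxK
  by_contra hxi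
  exact hx ⟨subset_closure hxK, hxi⟩

theorem movedBody_ae_eq (hK : IsSymmetricConvexBody K) (hv : v ≠ 0)
    (hb : ∀ y ∈ interior (projPerp v '' K), β y = b y) (t : ℝ) :
    movedBody K v β t =ᵐ[volume] shear v b (-t) ⁻¹' K := by
  filter_upwards [hK.ae_projPerp hv] with x hx
  rw [movedBody_eq_preimage]
  change (shear v β (-t) x ∈ K) = (shear v b (-t) x ∈ K)
  by_cases hxP : projPerp v x ∈ projPerp v '' K
  · simp only [shear, hb _ (hx hxP)]
  · refine propext ⟨fun h => (hxP ⟨_, h, ?_⟩).elim, fun h => (hxP ⟨_, h, ?_⟩).elim⟩ <;> simp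

theorem volume_movedBody (hK : IsSymmetricConvexBody K) (hv : v ≠ 0) (hbm : Measurable b)
    (hb : ∀ y ∈ interior (projPerp v '' K), β y = b y) (t : ℝ) :
    volume (movedBody K v β t) = volume K := by
  rw [measure_congr (movedBody_ae_eq hK hv hb t),
    (measurePreserving_shear hv hbm (-t)).measure_preimage
      hK.isCompact.isClosed.measurableSet.nullMeasurableSet]

theorem measurePreserving_shear_cond (hK : IsSymmetricConvexBody K) (hv : v ≠ 0)
    (hbm : Measurable b) (hb : ∀ y ∈ interior (projPerp v '' K), β y = b y) (t : ℝ) :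
    MeasurePreserving (shear v b t) (cond volume K) (cond volume (movedBody K v β t)) := by
  have h := (measurePreserving_shear hv hbm t).restrict_preimage
    (hK.isCompact.isClosed.measurableSet.preimage (measurable_shear hbm (-t)))
  have hpre : shear v b t ⁻¹' (shear v b (-t) ⁻¹' K) = K := by
    ext x
    simp [shear_neg_shear]
  rw [hpre, ← Measure.restrict_congr_set (movedBody_ae_eq hK hv hb t)] at h
  unfold ProbabilityTheory.cond
  rw [volume_movedBody hK hv hbm hb t]
  exact h.smul_measure _

/-- The volume of `conv {± x_i}` for the sheared points `x_i + t b(π_v x_i) v`. -/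
noncomputable def shearedHullVolume {N : ℕ} (v : EuclideanSpace ℝ (Fin n)) (b : perp v → ℝ) (t : ℝ)
    (x : Fin N → EuclideanSpace ℝ (Fin n)) : ℝ :=
  volume.real (symHull fun i => shear v b t (x i))

theorem shearedHullVolume_nonneg {N : ℕ} (t : ℝ) (x : Fin N → EuclideanSpace ℝ (Fin n)) :
    0 ≤ shearedHullVolume v b t x :=
  measureReal_nonneg

theorem shearedHullVolume_le {N : ℕ} [NeZero N] (hv : v ≠ 0)
    (x : Fin N → EuclideanSpace ℝ (Fin n)) {l m : ℝ} (hl : 0 ≤ l) (hm : 0 ≤ m) (hlm : l + m = 1)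
    (s t : ℝ) : shearedHullVolume v b (l * s + m * t) x ≤
      l * shearedHullVolume v b s x + m * shearedHullVolume v b t x :=
  volume_symHull_le hv x (fun i => b (projPerp v (x i))) hl hm hlm s t

theorem measurable_shearedHullVolume {N : ℕ} [NeZero N] (hbm : Measurable b) (t : ℝ) :
    Measurable (shearedHullVolume (N := N) v b t) := by
  refine (measurable_volume_symHull volume).comp (measurable_pi_lambda _ fun i => ?_)
  exact (measurable_shear hbm t).comp (measurable_pi_apply i)

theorem symMoment_movedBody {N : ℕ} [NeZero N] (hK : IsSymmetricConvexBody K) (hv : v ≠ 0)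
    (hbm : Measurable b) (hb : ∀ y ∈ interior (projPerp v '' K), β y = b y) (t p : ℝ) :
    symMoment (movedBody K v β t) N p =
      ∫ x : Fin N → EuclideanSpace ℝ (Fin n), (shearedHullVolume v b t x / volume.real K) ^ p
        ∂(Measure.pi fun _ => cond volume K) := by
  have hmp := measurePreserving_shear_cond hK hv hbm hb t
  have := hK.isProbabilityMeasure_cond
  have : IsProbabilityMeasure (cond volume (movedBody K v β t)) :=
    hmp.map_eq ▸ Measure.isProbabilityMeasure_map hmp.measurable.aemeasurable
  have hpi := measurePreserving_pi (fun _ : Fin N => cond volume K)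
    (fun _ => cond volume (movedBody K v β t)) fun _ => hmp
  have hvol : volume.real (movedBody K v β t) = volume.real K := by
    rw [Measure.real, Measure.real, volume_movedBody hK hv hbm hb t]
  rw [symMoment, ← hpi.map_eq, integral_map hpi.measurable.aemeasurable]
  · refine integral_congr_ae (Filter.Eventually.of_forall fun x => ?_)
    simp only [symHullVolume, hvol]
    rfl
  · refine Measurable.aestronglyMeasurable ?_
    exact ((measurable_volume_symHull volume).div_const _).pow_const p

theorem integrable_shearedHullVolume {N : ℕ} [NeZero N] (hK : IsSymmetricConvexBody K)
    (hmove : IsSRSMovement K v β I) (hbm : Measurable b)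
    (hb : ∀ y ∈ interior (projPerp v '' K), β y = b y) {t : ℝ} (ht : t ∈ I) {p : ℝ}
    (hp : 0 ≤ p) :
    Integrable (fun x : Fin N → EuclideanSpace ℝ (Fin n) =>
      (shearedHullVolume v b t x / volume.real K) ^ p)
      (Measure.pi fun _ => cond volume K) := by
  have hv := hmove.direction_ne_zero
  have := hK.isProbabilityMeasure_cond
  have hae : ∀ᵐ x ∂(cond volume K), x ∈ K ∧ projPerp v x ∈ interior (projPerp v '' K) := by
    filter_upwards [ae_cond_mem₀ hK.isCompact.isClosed.measurableSet.nullMeasurableSet,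
      cond_absolutelyContinuous.ae_le (hK.ae_projPerp hv)] with x hx hx'
    exact ⟨hx, hx' ⟨x, hx, rfl⟩⟩
  have hpi : ∀ᵐ x ∂(Measure.pi fun _ : Fin N => cond volume K),
      ∀ i, x i ∈ K ∧ projPerp v (x i) ∈ interior (projPerp v '' K) :=
    Filter.eventually_all.2 fun i =>
      (Measure.tendsto_eval_ae_ae (μ := fun _ : Fin N => ProbabilityTheory.cond volume K)
        (i := i)).eventually hae
  refine Integrable.of_bound (((measurable_shearedHullVolume hbm t).div_const _).pow_const
    p).aestronglyMeasurable 1 ?_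
  filter_upwards [hpi] with x hx
  -- Oddness of `β` makes `K_t` symmetric, so it contains the hull of the moved points and their
  -- negatives; the integrand is therefore at most `1`.
  have hsub : (symHull fun i => shear v b t (x i)) ⊆ movedBody K v β t := by
    refine symHull_subset (hmove.convex_movedBody t ht) ?_ ?_
    · rintro _ ⟨y, hy, rfl⟩
      refine ⟨-y, hK.neg_mem hy, ?_⟩
      simp only [map_neg, hmove.odd _ ⟨y, hy, rfl⟩]
      module
    · intro i
      refine ⟨x i, (hx i).1, ?_⟩
      simp only [hb _ (hx i).2, shear]
  have hle : shearedHullVolume v b t x ≤ volume.real K := by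
    have hvol := volume_movedBody hK hv hbm hb t
    have : volume.real (movedBody K v β t) = volume.real K := by
      rw [Measure.real, Measure.real, hvol]
    rw [← this]
    refine measureReal_mono hsub ?_
    rw [hvol]
    exact hK.isCompact.measure_lt_top.ne
  have h0 : 0 ≤ shearedHullVolume v b t x / volume.real K :=
    div_nonneg (shearedHullVolume_nonneg t x) measureReal_nonneg
  rw [Real.norm_of_nonneg (Real.rpow_nonneg h0 p)]
  exact Real.rpow_le_one h0 (div_le_one_of_le₀ hle measureReal_nonneg) hp

theorem shearedHullVolume_rpow_le {N : ℕ} [NeZero N] (hv : v ≠ 0) {c : ℝ} (hc : 0 ≤ c)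
    (x : Fin N → EuclideanSpace ℝ (Fin n)) {l m : ℝ} (hl : 0 ≤ l) (hm : 0 ≤ m) (hlm : l + m = 1)
    (s t : ℝ) {p : ℝ} (hp : 1 ≤ p) : (shearedHullVolume v b (l * s + m * t) x / c) ^ p ≤
      l * (shearedHullVolume v b s x / c) ^ p + m * (shearedHullVolume v b t x / c) ^ p := by
  have h0 : ∀ t, 0 ≤ shearedHullVolume v b t x / c := fun t =>
    div_nonneg (shearedHullVolume_nonneg t x) hc
  refine le_trans ?_ ((convexOn_rpow hp).2 (h0 s) (h0 t) hl hm hlm)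
  refine Real.rpow_le_rpow (h0 _) ?_ (by linarith)
  simp only [smul_eq_mul]
  rw [mul_div_assoc', mul_div_assoc', ← add_div]
  exact div_le_div_of_nonneg_right (shearedHullVolume_le hv x hl hm hlm s t) hc

theorem convexOn_symMoment {N : ℕ} [NeZero N] (hK : IsSymmetricConvexBody K)
    (hmove : IsSRSMovement K v β I) (hbm : Measurable b)
    (hb : ∀ y ∈ interior (projPerp v '' K), β y = b y) {p : ℝ} (hp : 1 ≤ p) :
    ConvexOn ℝ I fun t => symMoment (movedBody K v β t) N p := by
  have hv := hmove.direction_ne_zero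
  refine ⟨hmove.interval.convex, fun s hs t ht l m hl hm hlm => ?_⟩
  have hst := hmove.interval.convex hs ht hl hm hlm
  simp only [symMoment_movedBody hK hv hbm hb, smul_eq_mul] at hst ⊢
  have hp0 : 0 ≤ p := by linarith
  have his := integrable_shearedHullVolume (N := N) hK hmove hbm hb hs hp0
  have hit := integrable_shearedHullVolume (N := N) hK hmove hbm hb ht hp0
  rw [← integral_const_mul, ← integral_const_mul, ← integral_add (his.const_mul l)
    (hit.const_mul m)]
  refine integral_mono (integrable_shearedHullVolume hK hmove hbm hb hst hp0)
    ((his.const_mul l).add (hit.const_mul m)) fun x => ?_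
  exact shearedHullVolume_rpow_le hv measureReal_nonneg x hl hm hlm s t hp

theorem shearedHullVolume_linear {N : ℕ} (hv : v ≠ 0) (l : perp v →ₗ[ℝ] ℝ) (t : ℝ)
    (x : Fin N → EuclideanSpace ℝ (Fin n)) :
    shearedHullVolume v l t x = volume.real (symHull x) := by
  let T : EuclideanSpace ℝ (Fin n) →ₗ[ℝ] EuclideanSpace ℝ (Fin n) :=
    LinearMap.id + (t • (l ∘ₗ (projPerp v).toLinearMap)).smulRight v
  have hT : ∀ x, T x = shear v l t x := fun x => by
    simp [T, shear]
  have himg : (symHull fun i => shear v l t (x i)) = shear v l t '' symHull x := by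
    have := image_symHull T x
    rw [show (T : _ → _) = shear v l t from funext hT] at this
    exact this.symm
  rw [shearedHullVolume, himg, Measure.real, volume_image_shear hv
    l.continuous_of_finiteDimensional.measurable _
    (isCompact_symHull x).isClosed.measurableSet.nullMeasurableSet, Measure.real]

theorem symMoment_movedBody_of_linear {N : ℕ} [NeZero N] (hK : IsSymmetricConvexBody K)
    (hv : v ≠ 0) (h : IsLinearSpeed K v β) (s t p : ℝ) :
    symMoment (movedBody K v β s) N p = symMoment (movedBody K v β t) N p := by
  obtain ⟨l, hl⟩ := h
  have hlm : Measurable l := l.continuous_of_finiteDimensional.measurable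
  have hl' : ∀ y ∈ interior (projPerp v '' K), β y = l y := fun y hy => hl y (interior_subset hy)
  simp only [symMoment_movedBody hK hv hlm hl', shearedHullVolume_linear hv]

end Moment

/-! ### Determinants, cross-polytopes and configurations with an affine determinant. -/

section Determinant

/-- The determinant of `n` vectors of `ℝ^n`. -/
noncomputable def vecDet (n : ℕ) :
    EuclideanSpace ℝ (Fin n) [⋀^Fin n]→ₗ[ℝ] ℝ :=
  (EuclideanSpace.basisFun (Fin n) ℝ).toBasis.det

theorem vecDet_apply {n : ℕ} (x : Fin n → EuclideanSpace ℝ (Fin n)) :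
    vecDet n x = (Matrix.of fun i j => x i j).det := by
  rw [vecDet, Module.Basis.det_apply, ← Matrix.det_transpose]
  congr 1

theorem continuous_vecDet (n : ℕ) : Continuous (vecDet n) := by
  have : (vecDet n : _ → ℝ) = fun x => (Matrix.of fun i j => x i j).det := funext vecDet_apply
  rw [this]
  refine Continuous.matrix_det (continuous_matrix fun i j => ?_)
  simp only [Matrix.of_apply]
  fun_prop

theorem vecDet_ne_zero {n : ℕ} {x : Fin n → EuclideanSpace ℝ (Fin n)}
    (hx : LinearIndependent ℝ x) : vecDet n x ≠ 0 := by
  have hspan := hx.span_eq_top_of_card_eq_finrank' (by simp)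
  exact ((Module.Basis.is_basis_iff_det _).1 ⟨hx, hspan⟩).ne_zero

theorem linearIndependent_of_vecDet_ne_zero {n : ℕ} {x : Fin n → EuclideanSpace ℝ (Fin n)}
    (hx : vecDet n x ≠ 0) : LinearIndependent ℝ x ∧ Submodule.span ℝ (Set.range x) = ⊤ :=
  (Module.Basis.is_basis_iff_det _).2 hx.isUnit

/-- The volume of the standard cross-polytope. -/
noncomputable def crossVolume (n : ℕ) : ℝ :=
  volume.real (symHull (EuclideanSpace.basisFun (Fin n) ℝ).toBasis)

/-- The hull is the linear image of the standard cross-polytope under `e i ↦ x i`. Dependent points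
are included. -/
theorem volume_symHull_eq_vecDet {n : ℕ} (x : Fin n → EuclideanSpace ℝ (Fin n)) :
    volume.real (symHull x) = crossVolume n * |vecDet n x| := by
  set e := (EuclideanSpace.basisFun (Fin n) ℝ).toBasis with he
  have hA : (e.constr ℝ x) ∘ e = x := funext fun i => e.constr_basis ℝ x i
  have hdet : LinearMap.det (e.constr ℝ x) = vecDet n x := by
    conv_rhs => rw [← hA]
    rw [vecDet, ← he, e.det_comp, e.det_self, mul_one]
  rw [← hdet, crossVolume, ← he]
  conv_lhs => rw [← hA, ← image_symHull]
  rw [Measure.real, Measure.addHaar_image_linearMap, ENNReal.toReal_mul,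
    ENNReal.toReal_ofReal (abs_nonneg _), mul_comm, Measure.real]

theorem crossVolume_pos {n : ℕ} [NeZero n] : 0 < crossVolume n := by
  set e := (EuclideanSpace.basisFun (Fin n) ℝ).toBasis with he
  refine ENNReal.toReal_pos (Measure.measure_pos_of_nonempty_interior _ ⟨0, ?_⟩).ne'
    (isCompact_symHull _).measure_lt_top.ne
  have hopen : IsOpen {z : EuclideanSpace ℝ (Fin n) | ∑ i, |z i| < 1} :=
    isOpen_lt (by fun_prop) continuous_const
  refine mem_interior.2 ⟨_, ?_, hopen, by simp⟩
  intro z (hz : ∑ i, |z i| < 1)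
  rw [symHull_eq_image]
  refine ⟨fun i => z i, hz.le, ?_⟩
  have := e.sum_repr z
  simpa [he] using this

theorem eq_sum_vecDet_div_smul {n : ℕ} {x : Fin n → EuclideanSpace ℝ (Fin n)} (hx : vecDet n x ≠ 0)
    (z : EuclideanSpace ℝ (Fin n)) :
    z = ∑ i, (vecDet n (Function.update x i z) / vecDet n x) • x i := by
  obtain ⟨hli, hsp⟩ := linearIndependent_of_vecDet_ne_zero hx
  obtain ⟨c, rfl⟩ : ∃ c : Fin n → ℝ, ∑ i, c i • x i = z := by
    have : z ∈ Submodule.span ℝ (Set.range x) := hsp ▸ Submodule.mem_top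
    simpa [Submodule.mem_span_range_iff_exists_fun] using this
  refine Finset.sum_congr rfl fun i _ => ?_
  congr 1
  rw [eq_div_iff hx]
  have h : vecDet n (Function.update x i (∑ j, c j • x j)) =
      ∑ j, c j * vecDet n (Function.update x i (x j)) := by
    have h := map_sum ((vecDet n).toMultilinearMap.toLinearMap x i) (fun j => c j • x j)
      Finset.univ
    simp only [map_smul, smul_eq_mul] at h
    exact h
  rw [h, Finset.sum_eq_single i]
  · simp
  · intro j _ hj
    rw [(vecDet n).map_update_self x (Ne.symm hj), mul_zero]
  · simp

/-- Cramer's rule bounds the ℓ¹ norm of the coordinates of `z`. In this form the criterion is an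
open condition on `x` and `z`. -/
theorem mem_symHull_of_vecDet {n : ℕ} [NeZero n] {x : Fin n → EuclideanSpace ℝ (Fin n)}
    {z : EuclideanSpace ℝ (Fin n)}
    (h : ∑ i, |vecDet n (Function.update x i z)| < |vecDet n x|) : z ∈ symHull x := by
  have hpos : 0 < |vecDet n x| := (Finset.sum_nonneg fun i _ => abs_nonneg _).trans_lt h
  rw [symHull_eq_image]
  refine ⟨_, ?_, (eq_sum_vecDet_div_smul (abs_pos.1 hpos) z).symm⟩
  simp only [Set.mem_ofPred_eq, abs_div]
  rw [← Finset.sum_div, div_le_one hpos]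
  exact h.le

variable {m : ℕ} {v : EuclideanSpace ℝ (Fin (m + 1))}

theorem vecDet_cons_add_smul (w : Fin m → EuclideanSpace ℝ (Fin (m + 1))) (q : Fin m → ℝ) :
    vecDet (m + 1) (Fin.cons v fun i => w i + q i • v) = vecDet (m + 1) (Fin.cons v w) := by
  rw [vecDet_apply, vecDet_apply]
  refine Matrix.det_eq_of_forall_row_eq_smul_add_const (Fin.cons 0 q) 0 rfl ?_
  intro i j
  refine Fin.cases ?_ (fun i => ?_) i <;> simp

/-- Subtracting `a i` times the later rows from the first leaves `(q₀ - ∑ a i * q i) • v`: the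
height of the first point above the hyperplane spanned by the others. -/
theorem vecDet_cons_sum_add_smul (w : Fin m → EuclideanSpace ℝ (Fin (m + 1))) (a q : Fin m → ℝ)
    (q₀ : ℝ) :
    vecDet (m + 1) (Fin.cons (∑ i, a i • w i + q₀ • v) fun i => w i + q i • v) =
      (q₀ - ∑ i, a i * q i) * vecDet (m + 1) (Fin.cons v w) := by
  rw [← vecDet_cons_add_smul w q]
  set W : Fin m → EuclideanSpace ℝ (Fin (m + 1)) := fun i => w i + q i • v
  let φ : EuclideanSpace ℝ (Fin (m + 1)) →ₗ[ℝ] ℝ :=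
    (vecDet (m + 1)).toMultilinearMap.toLinearMap (Fin.cons 0 W) 0
  have hφ : ∀ z, vecDet (m + 1) (Fin.cons z W) = φ z := fun z => by
    simp [φ]
  have hW : ∀ i, φ (W i) = 0 := fun i => by
    rw [← hφ]
    exact (vecDet (m + 1)).map_eq_zero_of_eq _ (i := 0) (j := i.succ) (by simp)
      (Fin.succ_ne_zero i).symm
  have hw : ∀ i, φ (w i) = - (q i * φ v) := fun i => by
    have := hW i
    simp only [W, map_add, map_smul, smul_eq_mul] at this
    linarith
  rw [hφ, hφ]
  simp only [map_add, map_sum, map_smul, hw, smul_eq_mul, sub_mul, Finset.sum_mul]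
  simp only [mul_neg, Finset.sum_neg_distrib, mul_assoc]
  ring

theorem vecDet_cons_basis_ne_zero (hv : v ≠ 0) (e : Module.Basis (Fin m) ℝ (perp v)) :
    vecDet (m + 1) (Fin.cons v fun i => (e i : EuclideanSpace ℝ (Fin (m + 1)))) ≠ 0 := by
  refine vecDet_ne_zero (linearIndependent_finCons.2 ⟨?_, ?_⟩)
  · exact e.linearIndependent.map' (perp v).subtype (by simp)
  · intro hmem
    have hle : Submodule.span ℝ (Set.range fun i => (e i : EuclideanSpace ℝ (Fin (m + 1)))) ≤
        perp v := by
      rw [Submodule.span_le]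
      rintro _ ⟨i, rfl⟩
      exact (e i).2
    have := inner_perp ⟨v, hle hmem⟩
    simp only [inner_self_eq_zero] at this
    exact hv this

/-- Place one point over `y` and the others over `ε • e i`, with heights such that at time `t₀` all
lie on the graph of a linear `h`. The determinant is then `t - t₀` times the failure of `β y = ∑ y_i
β(ε e_i) / ε`, up to a nonzero factor. If no configuration worked, this identity would hold for all
small `ε > 0`, which forces `β` to be linear on the interior. -/
theorem exists_vecDet_shear {K : Set (EuclideanSpace ℝ (Fin (m + 1)))} {β : perp v → ℝ}
    (hK : IsSymmetricConvexBody K) (hv : v ≠ 0) (h0 : β 0 = 0)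
    (hβ : ContinuousOn β (interior (projPerp v '' K)))
    (hnl : ¬ ∃ l : perp v →ₗ[ℝ] ℝ, ∀ y ∈ interior (projPerp v '' K), β y = l y) (t₀ : ℝ) :
    ∃ x : Fin (m + 1) → EuclideanSpace ℝ (Fin (m + 1)), (∀ i, x i ∈ interior K) ∧
      ∃ κ : ℝ, κ ≠ 0 ∧ ∀ t, vecDet (m + 1) (fun i => shear v β t (x i)) = (t - t₀) * κ := by
  by_contra hcon
  apply hnl
  have hfin : Module.finrank ℝ (perp v) = m := by
    have : Fact (Module.finrank ℝ (EuclideanSpace ℝ (Fin (m + 1))) = m + 1) := ⟨by simp⟩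
    exact Submodule.finrank_orthogonal_span_singleton hv
  let e : Module.Basis (Fin m) ℝ (perp v) := Module.finBasisOfFinrankEq ℝ _ hfin
  have hzero : (0 : perp v) ∈ interior (projPerp v '' K) := by
    simpa using projPerp_mem_interior (v := v) hK.zero_mem_interior
  have hβ0 : ContinuousAt β 0 := hβ.continuousAt (isOpen_interior.mem_nhds hzero)
  have hsmul : ∀ i, Filter.Tendsto (fun ε : ℝ => ε • e i) (nhdsWithin 0 (Set.Ioi 0)) (nhds 0) := by
    intro i
    have : Continuous fun ε : ℝ => ε • e i := by fun_prop
    simpa using (this.tendsto 0).mono_left nhdsWithin_le_nhds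
  have key : ∀ y ∈ interior (projPerp v '' K), ∀ᶠ ε : ℝ in nhdsWithin 0 (Set.Ioi 0),
      β y = ∑ i, e.repr y i * (β (ε • e i) / ε) := by
    intro y hy
    by_cases hy0 : y = 0
    · simp [hy0, h0]
    obtain ⟨x', hx', hxy⟩ := hK.interior_image_subset hy
    obtain ⟨s, hs⟩ : ∃ s : ℝ, (y : EuclideanSpace ℝ (Fin (m + 1))) + s • v = x' :=
      ⟨_, hxy ▸ projPerp_add_smul v x'⟩
    -- The graph of `h` passes through the position at time `t₀` of the point `x'` over `y`. The
    -- other points start at height `h - t₀ β`, which tends to `0` with `ε` by continuity of `β` at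
    -- `0`, so they are interior to `K`.
    obtain ⟨h, hh⟩ : ∃ h : perp v →ₗ[ℝ] ℝ, h y = s + t₀ * β y := by
      refine ⟨((s + t₀ * β y) / ‖y‖ ^ 2) • (innerSL ℝ y).toLinearMap, ?_⟩
      have : ‖y‖ ≠ 0 := norm_ne_zero_iff.2 hy0
      simp only [LinearMap.smul_apply, ContinuousLinearMap.coe_coe, innerSL_apply_apply,
        real_inner_self_eq_norm_sq, smul_eq_mul]
      field_simp
    have hnear : ∀ i, ∀ᶠ ε : ℝ in nhdsWithin 0 (Set.Ioi 0),
        ((ε • e i : perp v) : EuclideanSpace ℝ (Fin (m + 1))) +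
          (h (ε • e i) - t₀ * β (ε • e i)) • v ∈ interior K := by
      intro i
      have hc : ContinuousAt (fun z : perp v => (z : EuclideanSpace ℝ (Fin (m + 1))) +
          (h z - t₀ * β z) • v) 0 := by
        have := h.continuous_of_finiteDimensional.continuousAt (x := 0)
        fun_prop
      have ht := hc.tendsto.comp (hsmul i)
      simp only [h0, map_zero, mul_zero, sub_zero, zero_smul, add_zero, ZeroMemClass.coe_zero] at ht
      exact ht.eventually_mem (isOpen_interior.mem_nhds hK.zero_mem_interior)
    filter_upwards [Filter.eventually_all.2 hnear, self_mem_nhdsWithin] with ε hε hε0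
    have hε0 : ε ≠ 0 := ne_of_gt hε0
    by_contra hne
    let w : Module.Basis (Fin m) ℝ (perp v) := e.unitsSMul fun _ => Units.mk0 ε hε0
    have hw : ∀ i, w i = ε • e i := fun i => by
      simp [w, Module.Basis.unitsSMul_apply, Units.smul_def]
    have hysum : y = ∑ i, (e.repr y i / ε) • (ε • e i) := by
      conv_lhs => rw [← e.sum_repr y]
      refine Finset.sum_congr rfl fun i _ => ?_
      rw [smul_smul, div_mul_cancel₀ _ hε0]
    have hycoe : (y : EuclideanSpace ℝ (Fin (m + 1))) =
        ∑ i, (e.repr y i / ε) • ((ε • e i : perp v) : EuclideanSpace ℝ (Fin (m + 1))) := by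
      conv_lhs => rw [hysum]
      push_cast
      rfl
    have hhsum : ∑ i, e.repr y i / ε * h (ε • e i) = s + t₀ * β y := by
      rw [← hh]
      conv_rhs => rw [hysum]
      simp only [map_sum, map_smul, smul_eq_mul]
    refine hcon ⟨Fin.cons x' fun i => ((ε • e i : perp v) : EuclideanSpace ℝ (Fin (m + 1))) +
          (h (ε • e i) - t₀ * β (ε • e i)) • v, fun i => Fin.cases hx' hε i,
      (β y - ∑ i, e.repr y i * (β (ε • e i) / ε)) * vecDet (m + 1)
        (Fin.cons v fun i => (w i : EuclideanSpace ℝ (Fin (m + 1)))),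
      mul_ne_zero (sub_ne_zero.2 hne) (vecDet_cons_basis_ne_zero hv w), fun t => ?_⟩
    have hpts : (fun i => shear v β t ((Fin.cons x' fun i =>
        ((ε • e i : perp v) : EuclideanSpace ℝ (Fin (m + 1))) +
          (h (ε • e i) - t₀ * β (ε • e i)) • v :
          Fin (m + 1) → EuclideanSpace ℝ (Fin (m + 1))) i)) =
        Fin.cons (∑ i, (e.repr y i / ε) •
            ((ε • e i : perp v) : EuclideanSpace ℝ (Fin (m + 1))) + (s + t * β y) • v)
          fun i => ((ε • e i : perp v) : EuclideanSpace ℝ (Fin (m + 1))) +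
            (h (ε • e i) + (t - t₀) * β (ε • e i)) • v := by
      funext i
      refine Fin.cases ?_ (fun i => ?_) i
      · simp only [Fin.cons_zero, ← hycoe, shear, hxy]
        rw [← hs]
        module
      · simp only [Fin.cons_succ, shear, map_add, map_smul, projPerp_coe, projPerp_self,
          smul_zero, add_zero]
        module
    rw [hpts, vecDet_cons_sum_add_smul]
    simp only [hw]
    rw [← mul_assoc]
    congr 1
    simp only [mul_add, Finset.sum_add_distrib, hhsum, mul_sub, Finset.mul_sum]
    have : ∀ i, e.repr y i / ε * ((t - t₀) * β (ε • e i)) =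
        (t - t₀) * (e.repr y i * (β (ε • e i) / ε)) := fun i => by ring
    simp only [this]
    ring
  -- Applying `key` to `y = η • e i` shows that the slope `β (ε • e i) / ε` equals the one at `η`
  -- for small `ε`; these slopes define the linear functional.
  obtain ⟨η, hη, hη0⟩ := ((Filter.eventually_all.2 fun i =>
    (hsmul i).eventually_mem (isOpen_interior.mem_nhds hzero)).and self_mem_nhdsWithin).exists
  have hη0 : η ≠ 0 := ne_of_gt hη0
  refine ⟨∑ i, (β (η • e i) / η) • e.coord i, fun y hy => ?_⟩
  obtain ⟨ε, hε, hεy⟩ := ((Filter.eventually_all.2 fun i => key (η • e i) (hη i)).and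
    (key y hy)).exists
  have hconst : ∀ i, β (ε • e i) / ε = β (η • e i) / η := by
    intro i
    rw [eq_div_iff hη0, hε i, Finset.sum_eq_single i]
    · simp [mul_comm]
    · intro j _ hj
      simp [Ne.symm hj]
    · simp
  rw [hεy]
  simp [hconst, mul_comm]

end Determinant

/-! ### Strict convexity for nonlinear speed. -/

section Strict

theorem IsSymmetricConvexBody.not_ae_pi_not {n N : ℕ} {K : Set (EuclideanSpace ℝ (Fin n))}
    (hK : IsSymmetricConvexBody K) {x₀ : Fin N → EuclideanSpace ℝ (Fin n)}
    (hx₀ : ∀ i, x₀ i ∈ interior K) {P : (Fin N → EuclideanSpace ℝ (Fin n)) → Prop}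
    (hP : ∀ᶠ x in nhds x₀, P x) :
    ¬ ∀ᵐ x ∂(Measure.pi fun _ : Fin N => ProbabilityTheory.cond volume K), ¬ P x := by
  intro hae
  have := hK.isProbabilityMeasure_cond
  obtain ⟨ε, hε, hball⟩ := Metric.eventually_nhds_iff_ball.1 hP
  have hnull : (Measure.pi fun _ : Fin N => ProbabilityTheory.cond volume K)
      (Metric.ball x₀ ε) = 0 := by
    refine measure_mono_null (fun x hx => ?_) (ae_iff.1 hae)
    exact not_not.2 (hball x hx)
  rw [ball_pi _ hε, Measure.pi_pi, Finset.prod_eq_zero_iff] at hnull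
  obtain ⟨i, -, hi⟩ := hnull
  rw [cond_apply' measurableSet_ball, mul_eq_zero, ENNReal.inv_eq_zero] at hi
  rcases hi with hi | hi
  · exact hK.isCompact.measure_lt_top.ne hi
  · exact (Measure.measure_pos_of_mem_nhds volume (Filter.inter_mem (mem_interior_iff_mem_nhds.1 (hx₀ i))
      (Metric.ball_mem_nhds _ hε))).ne' hi

variable {m : ℕ} {K : Set (EuclideanSpace ℝ (Fin (m + 1)))}
  {v : EuclideanSpace ℝ (Fin (m + 1))} {β b : perp v → ℝ} {I : Set ℝ}

theorem shearedHullVolume_eq_vecDet {N : ℕ} (hN : m + 1 ≤ N) {t : ℝ}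
    {x : Fin N → EuclideanSpace ℝ (Fin (m + 1))}
    (h : ∀ j : Fin N, m + 1 ≤ (j : ℕ) →
      ∑ i, |vecDet (m + 1) (Function.update (fun i => shear v b t (x (Fin.castLE hN i))) i
        (shear v b t (x j)))| < |vecDet (m + 1) fun i => shear v b t (x (Fin.castLE hN i))|) :
    shearedHullVolume v b t x =
      crossVolume (m + 1) * |vecDet (m + 1) fun i => shear v b t (x (Fin.castLE hN i))| := by
  rw [← volume_symHull_eq_vecDet, shearedHullVolume]
  congr 1
  refine symHull_eq_of_forall_mem (x := fun i => shear v b t (x i)) (Fin.castLE hN) fun j => ?_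
  rcases lt_or_ge (j : ℕ) (m + 1) with hj | hj
  · exact subset_convexHull ℝ _ (Or.inl ⟨⟨j, hj⟩, rfl⟩)
  · exact mem_symHull_of_vecDet (h j hj)

theorem exists_eventually_shearedHullVolume_lt {N : ℕ} (hN : m + 1 ≤ N)
    (hK : IsSymmetricConvexBody K) (hv : v ≠ 0) (h0 : b 0 = 0)
    (hb : ContinuousOn b (interior (projPerp v '' K)))
    (hnl : ¬ ∃ l : perp v →ₗ[ℝ] ℝ, ∀ y ∈ interior (projPerp v '' K), b y = l y)
    {s t : ℝ} (hst : s ≠ t) {l r : ℝ} (hl : 0 < l) (hr : 0 < r) (hlr : l + r = 1) :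
    ∃ x₀ : Fin N → EuclideanSpace ℝ (Fin (m + 1)), (∀ i, x₀ i ∈ interior K) ∧
      ∀ᶠ x in nhds x₀, shearedHullVolume v b (l * s + r * t) x <
        l * shearedHullVolume v b s x + r * shearedHullVolume v b t x := by
  set c := l * s + r * t with hc
  -- The kink lies strictly between `s` and `c`, not at `c`: the determinant is then nonzero at all
  -- three times `s`, `c`, `t`, so the cross-polytopes are nondegenerate and absorb the extra points
  -- near `0`.
  obtain ⟨z, hz, κ, hκ, hdet⟩ := exists_vecDet_shear hK hv h0 hb hnl ((s + c) / 2)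
  let x₀ : Fin N → EuclideanSpace ℝ (Fin (m + 1)) :=
    fun j => if h : (j : ℕ) < m + 1 then z ⟨j, h⟩ else 0
  have hx₀z : ∀ i, x₀ (Fin.castLE hN i) = z i := fun i => dif_pos i.2
  have hx₀ : ∀ i, x₀ i ∈ interior K := by
    intro i
    by_cases hi : (i : ℕ) < m + 1
    · rw [show x₀ i = z ⟨i, hi⟩ from dif_pos hi]
      exact hz _
    · rw [show x₀ i = 0 from dif_neg hi]
      exact hK.zero_mem_interior
  refine ⟨x₀, hx₀, ?_⟩
  have hcont : ∀ (u : ℝ) (j : Fin N),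
      ContinuousAt (fun x : Fin N → EuclideanSpace ℝ (Fin (m + 1)) => shear v b u (x j)) x₀ := by
    intro u j
    have hbj : ContinuousAt b (projPerp v (x₀ j)) :=
      hb.continuousAt (isOpen_interior.mem_nhds (projPerp_mem_interior (hx₀ j)))
    have hπ : ContinuousAt (fun x : Fin N → EuclideanSpace ℝ (Fin (m + 1)) => projPerp v (x j))
        x₀ := ((projPerp v).continuous.comp (continuous_apply j)).continuousAt
    have hbπ : ContinuousAt (fun x : Fin N → EuclideanSpace ℝ (Fin (m + 1)) =>
        b (projPerp v (x j))) x₀ := ContinuousAt.comp (g := b) hbj hπ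
    exact (continuous_apply j).continuousAt.add ((hbπ.const_mul u).smul continuousAt_const)
  have hcontG : ∀ u : ℝ, ContinuousAt (fun (x : Fin N → EuclideanSpace ℝ (Fin (m + 1)))
      (i : Fin (m + 1)) => shear v b u (x (Fin.castLE hN i))) x₀ :=
    fun u => continuousAt_pi.2 fun i => hcont u _
  have hcontD : ∀ u : ℝ, ContinuousAt (fun x : Fin N → EuclideanSpace ℝ (Fin (m + 1)) =>
      |vecDet (m + 1) fun i => shear v b u (x (Fin.castLE hN i))|) x₀ :=
    fun u => (ContinuousAt.comp (g := vecDet (m + 1)) (continuous_vecDet _).continuousAt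
      (hcontG u)).abs
  have hhull : ∀ u : ℝ, u ≠ (s + c) / 2 → ∀ᶠ x in nhds x₀, shearedHullVolume v b u x =
      crossVolume (m + 1) * |vecDet (m + 1) fun i => shear v b u (x (Fin.castLE hN i))| := by
    intro u hu
    have : ∀ᶠ x in nhds x₀, ∀ j : Fin N, m + 1 ≤ (j : ℕ) →
        ∑ i, |vecDet (m + 1) (Function.update (fun i => shear v b u (x (Fin.castLE hN i))) i
          (shear v b u (x j)))| < |vecDet (m + 1) fun i => shear v b u (x (Fin.castLE hN i))| := by
      refine Filter.eventually_all.2 fun j => ?_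
      by_cases hj : m + 1 ≤ (j : ℕ)
      · have hlhs : ContinuousAt (fun x : Fin N → EuclideanSpace ℝ (Fin (m + 1)) =>
            ∑ i, |vecDet (m + 1) (Function.update (fun i => shear v b u (x (Fin.castLE hN i))) i
              (shear v b u (x j)))|) x₀ := by
          refine tendsto_finsetSum _ fun i _ => ?_
          exact (ContinuousAt.comp (g := vecDet (m + 1)) (continuous_vecDet _).continuousAt
            ((hcontG u).update i (hcont u j))).abs
        refine (hlhs.eventually_lt (hcontD u) ?_).mono fun x hx _ => hx
        have hzero : shear v b u (x₀ j) = 0 := by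
          rw [show x₀ j = 0 from dif_neg (not_lt.2 hj)]
          simp [shear, h0]
        rw [hzero]
        simp only [AlternatingMap.map_update_zero, abs_zero, Finset.sum_const_zero, hx₀z, hdet]
        exact abs_pos.2 (mul_ne_zero (sub_ne_zero.2 hu) hκ)
      · exact Filter.Eventually.of_forall fun x h => (hj h).elim
    exact this.mono fun x hx => shearedHullVolume_eq_vecDet hN hx
  have hr1 : r < 1 := by linarith
  have hts : 0 < |t - s| := abs_pos.2 (sub_ne_zero.2 hst.symm)
  have hes : |s - (s + c) / 2| = r / 2 * |t - s| := by
    rw [show s - (s + c) / 2 = -(r / 2 * (t - s)) by rw [hc, eq_sub_of_add_eq hlr]; ring, abs_neg,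
      abs_mul, abs_of_pos (half_pos hr)]
  have hec : |c - (s + c) / 2| = r / 2 * |t - s| := by
    rw [show c - (s + c) / 2 = r / 2 * (t - s) by rw [hc, eq_sub_of_add_eq hlr]; ring, abs_mul,
      abs_of_pos (half_pos hr)]
  have het : |t - (s + c) / 2| = (1 - r / 2) * |t - s| := by
    rw [show t - (s + c) / 2 = (1 - r / 2) * (t - s) by rw [hc, eq_sub_of_add_eq hlr]; ring,
      abs_mul, abs_of_pos (by linarith)]
  have hne : ∀ u, 0 < |u - (s + c) / 2| → u ≠ (s + c) / 2 := fun u hu =>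
    sub_ne_zero.1 (abs_pos.1 hu)
  have hlt : ∀ᶠ x in nhds x₀, |vecDet (m + 1) fun i => shear v b c (x (Fin.castLE hN i))| <
      l * |vecDet (m + 1) fun i => shear v b s (x (Fin.castLE hN i))| +
      r * |vecDet (m + 1) fun i => shear v b t (x (Fin.castLE hN i))| := by
    refine (hcontD c).eventually_lt (((hcontD s).const_mul l).add ((hcontD t).const_mul r)) ?_
    simp only [hx₀z, hdet, abs_mul, hes, hec, het]
    -- This is the gap in the inequality at `x₀`, since `(1 - r) * (r / 2) + r * (1 - r / 2) - r / 2
    -- = r - r ^ 2`.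
    have hpos : 0 < (r - r ^ 2) * (|t - s| * |κ|) := by
      have : 0 < r - r ^ 2 := by nlinarith
      have := abs_pos.2 hκ
      positivity
    rw [eq_sub_of_add_eq hlr]
    linarith
  filter_upwards [hlt, hhull s (hne s (by rw [hes]; positivity)),
    hhull t (hne t (by rw [het]; exact mul_pos (by linarith) hts)),
    hhull c (hne c (by rw [hec]; positivity))] with x hx h1 h2 h3
  rw [h1, h2, h3]
  have := mul_lt_mul_of_pos_left hx (crossVolume_pos (n := m + 1))
  linarith

theorem strictConvexOn_symMoment {N : ℕ} (hN : m + 1 ≤ N) [NeZero N]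
    (hK : IsSymmetricConvexBody K) (hmove : IsSRSMovement K v β I) (hbm : Measurable b)
    (hbβ : ∀ y ∈ interior (projPerp v '' K), β y = b y) (hI : I.Nontrivial)
    (hnl : ¬ IsLinearSpeed K v β) {p : ℝ} (hp : 1 ≤ p) :
    StrictConvexOn ℝ I fun t => symMoment (movedBody K v β t) N p := by
  have hv := hmove.direction_ne_zero
  have hzero : (0 : perp v) ∈ interior (projPerp v '' K) := by
    simpa using projPerp_mem_interior (v := v) hK.zero_mem_interior
  have h0 : b 0 = 0 := by rw [← hbβ 0 hzero, hmove.apply_zero hK]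
  have hbc : ContinuousOn b (interior (projPerp v '' K)) :=
    (hmove.continuousOn hK hI).congr fun y hy => (hbβ y hy).symm
  have hnl' : ¬ ∃ l : perp v →ₗ[ℝ] ℝ, ∀ y ∈ interior (projPerp v '' K), b y = l y := by
    rintro ⟨l, hl⟩
    exact hnl ⟨l, fun y hy => hmove.eq_of_eq_on_interior hK hI
      (fun y hy => (hbβ y hy).trans (hl y hy)) hy⟩
  have hconv := convexOn_symMoment (N := N) hK hmove hbm hbβ hp
  refine ⟨hconv.1, fun s hs t ht hst l r hl hr hlr => ?_⟩
  refine lt_of_le_of_ne (hconv.2 hs ht hl.le hr.le hlr) fun heq => ?_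
  have hst' := hconv.1 hs ht hl.le hr.le hlr
  simp only [symMoment_movedBody hK hv hbm hbβ, smul_eq_mul] at hst' heq
  have hp0 : 0 ≤ p := by linarith
  have his := integrable_shearedHullVolume (N := N) hK hmove hbm hbβ hs hp0
  have hit := integrable_shearedHullVolume (N := N) hK hmove hbm hbβ ht hp0
  have hic := integrable_shearedHullVolume (N := N) hK hmove hbm hbβ hst' hp0
  rw [← integral_const_mul, ← integral_const_mul, ← integral_add (his.const_mul l)
    (hit.const_mul r)] at heq
  -- Equality of the integrals would force equality of the ordered integrands almost everywhere,
  -- against strict inequality near `x₀`.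
  have hae := (integral_eq_iff_of_ae_le hic ((his.const_mul l).add (hit.const_mul r))
    (Filter.Eventually.of_forall fun x =>
      shearedHullVolume_rpow_le hv measureReal_nonneg x hl.le hr.le hlr s t hp)).1 heq
  obtain ⟨x₀, hx₀, hlt⟩ := exists_eventually_shearedHullVolume_lt hN hK hv h0 hbc hnl' hst hl hr hlr
  refine hK.not_ae_pi_not hx₀ hlt ?_
  filter_upwards [hae] with x hx hlt
  have hVK := hK.volume_real_pos
  have hnn : ∀ u, 0 ≤ shearedHullVolume v b u x / volume.real K := fun u =>
    div_nonneg (shearedHullVolume_nonneg u x) hVK.le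
  refine absurd hx (ne_of_lt ?_)
  -- Strictness comes from the volumes and the strict monotonicity of `u ↦ u ^ p`; only weak
  -- convexity of the power is used, so `p = 1` is covered.
  refine lt_of_lt_of_le ?_ ((convexOn_rpow hp).2 (hnn s) (hnn t) hl.le hr.le hlr)
  refine Real.rpow_lt_rpow (hnn _) ?_ (by linarith)
  simp only [smul_eq_mul]
  rw [mul_div_assoc', mul_div_assoc', ← add_div]
  exact div_lt_div_of_pos_right hlt hVK

end Strict

theorem mainTheorem2 {n : ℕ} (hn : 2 ≤ n) (K : Set (EuclideanSpace ℝ (Fin n)))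
    (hK : IsSymmetricConvexBody K) (v : EuclideanSpace ℝ (Fin n)) (β : perp v → ℝ)
    (I : Set ℝ) (hI : I.Nontrivial) (hmove : IsSRSMovement K v β I)
    (p : ℝ) (hp : 1 ≤ p) (N : ℕ) (hN : n ≤ N) :
    ConvexOn ℝ I (fun t => symMoment (movedBody K v β t) N p) ∧
      (StrictConvexOn ℝ I (fun t => symMoment (movedBody K v β t) N p) ↔
        ¬ IsLinearSpeed K v β) := by
  obtain ⟨m, rfl⟩ : ∃ m, n = m + 1 := ⟨n - 1, by omega⟩
  have : NeZero N := ⟨by omega⟩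
  classical
  -- The measurable substitute `b` is `β` cut off to the interior of the projection, where it is
  -- continuous.
  have hbm : Measurable ((interior (projPerp v '' K)).indicator β) :=
    (hmove.continuousOn hK hI).measurable_piecewise continuousOn_const
      isOpen_interior.measurableSet
  have hb : ∀ y ∈ interior (projPerp v '' K),
      β y = (interior (projPerp v '' K)).indicator β y :=
    fun y hy => (Set.indicator_of_mem hy β).symm
  refine ⟨convexOn_symMoment hK hmove hbm hb hp, fun hstrict hlin => ?_,
    fun hnl => strictConvexOn_symMoment hN hK hmove hbm hb hI hnl hp⟩
  obtain ⟨s, hs, t, ht, hst⟩ := hI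
  have hlt := hstrict.2 hs ht hst (by norm_num : (0 : ℝ) < 1 / 2)
    (by norm_num : (0 : ℝ) < 1 / 2) (by norm_num)
  have hconst := fun u =>
    symMoment_movedBody_of_linear (N := N) hK hmove.direction_ne_zero hlin u 0 p
  simp only [hconst, smul_eq_mul] at hlt
  linarith
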